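/- Let $f(t)=\mathbb E\,e^{itX}$ be the characteristic function of a non-degenerate real random variable $X$ (one whose law is not concentrated at a single point). Suppose that for some $r>0$ the function $f$ is analytic in the disk $|t|<r$, that is, it agrees on $(-r,r)$ with a holomorphic function on the complex disk $|t|<r$, with expansion $f(t)=\sum_{k\ge 0}a_kt^k$. Let $\mathfrak M=\{\mu_k/k! : k=0,1,2,\dots\}$, where $\mu_k=\mathbb E X^k$. If $\mathfrak M$ is finite, or if the set of coefficients $\{a_k : k=0,1,2,\dots\}$ is finite, then $f$ has one of the forms $$f(t)=\frac{1+iat}{1+it}\quad\text{or}\quad f(t)=\frac{1-iat}{1-it},\qquad\text{where } 0\le a\le 1, \tag{1}$$ or $$f(t)=\frac{1+iat+bt^2}{1+t^2},\qquad\text{where } a,b\in\mathbb R,\ b\ge 0,\ \frac{1-a-b}{2}\ge 0,\ \frac{1+a-b}{2}\ge 0, \tag{2}$$ for all real $t$. Conversely, every function $f$ of the form (1) or (2) is analytic in a disk around $0$ and the set of its Taylor coefficients at $0$ is finite; and if $f$ is the characteristic function of a real random variable, then all moments $\mu_k$ of this variable are finite and the set $\mathfrak M$ is finite. -/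

import Mathlib

open MeasureTheory

/-- A probability law on the real line is non-degenerate if it is not concentrated at one point. -/
def NonDegenerate (μ : Measure ℝ) : Prop :=
  ∀ c : ℝ, μ ≠ Measure.dirac c

/-- The set of all values `μ_k / k!`, `k = 0, 1, 2, …`, where `μ_k = ∫ x ^ k dμ` is the moment
of order `k`. -/
noncomputable def momentRatios (μ : Measure ℝ) : Set ℝ :=
  Set.range fun k : ℕ => (∫ x, x ^ k ∂μ) / (k.factorial : ℝ)

/-- The function `f` of a real variable is analytic in the complex disk `|z| < r`, with power
series `∑ a_k z ^ k` there: it agrees on `(-r, r)` with a holomorphic function on the disk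
which has this expansion. -/
def IsAnalyticInDisk (f : ℝ → ℂ) (a : ℕ → ℂ) (r : ℝ) : Prop :=
  ∃ F : ℂ → ℂ, AnalyticOnNhd ℂ F (Metric.ball 0 r) ∧
    (∀ z ∈ Metric.ball (0 : ℂ) r, HasSum (fun k : ℕ => a k * z ^ k) (F z)) ∧
    ∀ t : ℝ, |t| < r → F (t : ℂ) = f t

/-- `f(t) = (1 ± i a t) / (1 ± i t)` with `0 ≤ a ≤ 1`; both signs are equal. -/
def IsFirstForm (f : ℝ → ℂ) : Prop :=
  ∃ a : ℝ, 0 ≤ a ∧ a ≤ 1 ∧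
    ((∀ t : ℝ, f t = (1 + Complex.I * a * t) / (1 + Complex.I * t)) ∨
     (∀ t : ℝ, f t = (1 - Complex.I * a * t) / (1 - Complex.I * t)))

/-- `f(t) = (1 + i a t + b t²) / (1 + t²)` with `b`, `(1 - a - b) / 2`, `(1 + a - b) / 2`
non-negative. -/
def IsSecondForm (f : ℝ → ℂ) : Prop :=
  ∃ a b : ℝ, 0 ≤ b ∧ 0 ≤ (1 - a - b) / 2 ∧ 0 ≤ (1 + a - b) / 2 ∧
    ∀ t : ℝ, f t = (1 + Complex.I * a * t + b * (t : ℂ) ^ 2) / (1 + (t : ℂ) ^ 2)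

/-!
Write `c k = μ_k / k!`. Analyticity of the characteristic function at `0` makes all moments finite
(symmetric second differences, `integrable_pow_add_two`) and gives `a k = i ^ k * c k`; hence the
`a k` take finitely many values if and only if the `c k` do, and `charFun μ` is real analytic on all
of `ℝ`.

The heart of the proof is `exists_eventually_momentRatio_eq`: if the `c k` take finitely many values,
they are eventually constant, say `C` at the even and `D` at the odd indices, and `|D| ≤ C`. For even
`m`, the integral of `x ^ m * (p + q * (x / m) + r * (x / m) ^ 2) ^ 2 / m!` is non-negative, and is
the quadratic form of the Hankel matrix `(c (m + i + j))`, `0 ≤ i, j ≤ 2`, up to factors that tend to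
`1` as `m → ∞`. As only finitely many such matrices occur, those with large `m` recur infinitely often
and so are positive semidefinite exactly. Hence the even-indexed `c k` are eventually log-convex; being
positive with finitely many values, they are eventually constant. Then `(1, 0, -1)` is an isotropic
vector of the form, so it lies in the kernel, which says `c (m + 1) = c (m + 3)`.

Near `0`, therefore, the characteristic function is a polynomial plus `(C + i D t) / (1 + t ^ 2)`. This
persists on `ℝ` by analyticity, the polynomial is bounded there and so equals the constant `1 - C`, and
`1 - C ≥ 0` because otherwise uniqueness of characteristic functions would give a combination of two
exponential laws an atom at `0`. This is the second form, of which the first is a special case.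

Conversely, the Taylor coefficients of the second form are explicit, and finiteness of the moments and
of the set of their ratios to factorials follows from the same facts about analytic characteristic
functions.
-/

open Filter Topology ProbabilityTheory

/-! ### Moments and exponential moments from analyticity -/

/-- The constant terms cancel in the symmetric second difference, and so do the linear ones. -/
lemma AnalyticAt.second_difference_isBigO {g : ℝ → ℂ} (hg : AnalyticAt ℝ g 0) :
    (fun t : ℝ => g t + g (-t) - 2 * g 0) =O[𝓝 0] fun t : ℝ => t ^ 2 := by
  obtain ⟨p, hp⟩ := hg
  have h1 := hp.isBigO_sub_partialSum_pow 2
  have h2 := h1.comp_tendsto (k := fun t : ℝ => -t) (l' := 𝓝 0)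
    (by simpa using (continuous_neg (G := ℝ)).tendsto 0)
  simp only [zero_add] at h1
  have h3 := h1.add (h2.congr_right (g₂ := fun t : ℝ => ‖t‖ ^ 2) (by simp))
  have h0 : p.coeff 0 = g 0 := hp.coeff_zero _
  refine (h3.congr ?_ ?_)
  · intro t
    simp [FormalMultilinearSeries.partialSum, Finset.sum_range_succ, h0]
    ring
  · simp

lemma memLp_id_of_integrable_pow {μ : Measure ℝ} [IsFiniteMeasure μ] {k : ℕ}
    (h : Integrable (fun x : ℝ => x ^ k) μ) : MemLp id k μ := by
  rcases eq_or_ne k 0 with rfl | hk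
  · simpa using aestronglyMeasurable_id
  · refine (integrable_norm_rpow_iff aestronglyMeasurable_id (by simpa using hk) (by simp)).1 ?_
    simpa using h.norm

/-- The function `(-1) ^ k * iteratedDeriv (2 * k) (charFun μ)` is the Fourier transform of
`x ^ (2 * k) dμ`. Its symmetric second difference at `0` is
`-2 * ∫ x ^ (2 * k) * (1 - cos (t * x))`; as this is `O(t ^ 2)`, the integrals of
`x ^ (2 * (k + 1))` over `[-s, s]` stay bounded. -/
lemma integrable_pow_add_two {μ : Measure ℝ} [IsFiniteMeasure μ]
    (han : AnalyticAt ℝ (charFun μ) 0) {k : ℕ} (h : Integrable (fun x : ℝ => x ^ (2 * k)) μ) :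
    Integrable (fun x : ℝ => x ^ (2 * (k + 1))) μ := by
  have hg : AnalyticAt ℝ (iteratedDeriv (2 * k) (charFun μ)) 0 := by
    rw [iteratedDeriv_eq_iterate]; exact han.iterated_deriv _
  obtain ⟨C, hC⟩ := hg.second_difference_isBigO.bound
  have hint : ∀ t : ℝ, Integrable (fun x : ℝ => x ^ (2 * k) * (1 - Real.cos (t * x))) μ := by
    intro t
    refine h.mul_bdd (c := 2) (by fun_prop) (.of_forall fun x => ?_)
    rw [Real.norm_eq_abs, abs_le]
    constructor <;> linarith [Real.neg_one_le_cos (t * x), Real.cos_le_one (t * x)]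
  have hintc : ∀ t : ℝ, Integrable
      (fun x : ℝ => (x : ℂ) ^ (2 * k) * Complex.exp (t * x * Complex.I)) μ := by
    intro t
    have h' : Integrable (fun x : ℝ => (x : ℂ) ^ (2 * k)) μ := by exact_mod_cast h.ofReal (𝕜 := ℂ)
    refine h'.mul_bdd (c := 1) (by fun_prop) (.of_forall fun x => ?_)
    exact_mod_cast (Complex.norm_exp_ofReal_mul_I (t * x)).le
  have key : ∀ t : ℝ, ‖iteratedDeriv (2 * k) (charFun μ) t + iteratedDeriv (2 * k) (charFun μ) (-t)
      - 2 * iteratedDeriv (2 * k) (charFun μ) 0‖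
        = 2 * ∫ x, x ^ (2 * k) * (1 - Real.cos (t * x)) ∂μ := by
    intro t
    simp only [iteratedDeriv_charFun (memLp_id_of_integrable_pow h)]
    have : (∫ x : ℝ, (x : ℂ) ^ (2 * k) * Complex.exp (t * x * Complex.I) ∂μ)
        + (∫ x : ℝ, (x : ℂ) ^ (2 * k) * Complex.exp ((-t : ℝ) * x * Complex.I) ∂μ)
        - 2 * (∫ x : ℝ, (x : ℂ) ^ (2 * k) * Complex.exp ((0 : ℝ) * x * Complex.I) ∂μ)
        = ((-2 * ∫ x, x ^ (2 * k) * (1 - Real.cos (t * x)) ∂μ : ℝ) : ℂ) := by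
      rw [← integral_const_mul, ← integral_const_mul, ← integral_complex_ofReal,
        ← integral_add (hintc t) (hintc (-t)), ← integral_sub ?_ ((hintc 0).const_mul 2)]
      swap
      · exact (hintc t).add (hintc (-t))
      refine integral_congr_ae (.of_forall fun x => ?_)
      have := Complex.two_cos ((t * x : ℝ) : ℂ)
      push_cast at this ⊢
      simp only [neg_mul] at this ⊢
      simp only [zero_mul, Complex.exp_zero]
      linear_combination (-(x : ℂ) ^ (2 * k)) * this
    have e2 : ∀ A B D : ℂ, Complex.I ^ (2 * k) * A + Complex.I ^ (2 * k) * B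
        - 2 * (Complex.I ^ (2 * k) * D) = Complex.I ^ (2 * k) * (A + B - 2 * D) := by
      intros; ring
    rw [e2, this, norm_mul, norm_pow, Complex.norm_I, one_pow, one_mul, Complex.norm_real,
      Real.norm_eq_abs, abs_mul, abs_neg, abs_two, abs_of_nonneg]
    refine integral_nonneg fun x => mul_nonneg ((even_two_mul k).pow_nonneg x) ?_
    linarith [Real.cos_le_one (t * x)]
  have hev : ∀ x : ℝ, 0 ≤ x ^ (2 * (k + 1)) := fun x => (even_two_mul (k + 1)).pow_nonneg x
  have hcov : AECover μ (atTop : Filter ℝ) fun s : ℝ => Set.Icc (-s) s :=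
    aecover_Icc tendsto_neg_atTop_atBot tendsto_id
  refine hcov.integrable_of_integral_bounded_of_nonneg_ae (Real.pi ^ 2 / 4 * C) (fun s =>
    (by fun_prop : Continuous fun x : ℝ => x ^ (2 * (k + 1))).integrableOn_Icc)
    (.of_forall hev) ?_
  filter_upwards [tendsto_inv_atTop_zero.eventually hC, eventually_gt_atTop (0 : ℝ)] with s hs hs0
  rw [key, Real.norm_eq_abs, abs_of_nonneg (sq_nonneg _)] at hs
  -- On `|x| ≤ s` the function `x ^ 2` is at most `(π s) ^ 2 / 2 * (1 - cos (x / s))`.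
  have hle : ∫ x in Set.Icc (-s) s, x ^ (2 * (k + 1)) ∂μ ≤
      ∫ x in Set.Icc (-s) s, Real.pi ^ 2 / 2 * s ^ 2 *
        (x ^ (2 * k) * (1 - Real.cos (s⁻¹ * x))) ∂μ := by
    refine setIntegral_mono_on
      (by fun_prop : Continuous fun x : ℝ => x ^ (2 * (k + 1))).integrableOn_Icc
      ((hint s⁻¹).const_mul _).integrableOn measurableSet_Icc fun x hx => ?_
    have hx' : |s⁻¹ * x| ≤ Real.pi := by
      rw [abs_mul, abs_inv, abs_of_pos hs0, inv_mul_le_iff₀ hs0]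
      calc |x| ≤ s := abs_le.2 hx
        _ = s * 1 := (mul_one s).symm
        _ ≤ s * Real.pi := by gcongr; linarith [Real.pi_gt_three]
    have h1 := Real.cos_le_one_sub_mul_cos_sq hx'
    have h2 : x ^ 2 ≤ Real.pi ^ 2 / 2 * s ^ 2 * (1 - Real.cos (s⁻¹ * x)) := by
      have : Real.pi ^ 2 / 2 * s ^ 2 * (2 / Real.pi ^ 2 * (s⁻¹ * x) ^ 2) = x ^ 2 := by
        field_simp
      rw [← this]
      gcongr
      linarith
    calc x ^ (2 * (k + 1)) = x ^ (2 * k) * x ^ 2 := by ring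
      _ ≤ x ^ (2 * k) * (Real.pi ^ 2 / 2 * s ^ 2 * (1 - Real.cos (s⁻¹ * x))) :=
        mul_le_mul_of_nonneg_left h2 ((even_two_mul k).pow_nonneg x)
      _ = _ := by ring
  refine hle.trans ((setIntegral_le_integral ((hint s⁻¹).const_mul _) (.of_forall fun x => ?_)).trans
    ?_)
  · have : 0 ≤ 1 - Real.cos (s⁻¹ * x) := by linarith [Real.cos_le_one (s⁻¹ * x)]
    have := (even_two_mul k).pow_nonneg x
    simp only [Pi.zero_apply]
    positivity
  · rw [integral_const_mul]
    calc _ ≤ Real.pi ^ 2 / 2 * s ^ 2 * (C * s⁻¹ ^ 2 / 2) := by gcongr; linarith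
      _ = Real.pi ^ 2 / 4 * C := by field_simp; ring

/-- If the characteristic function is analytic at `0`, then all moments are finite. -/
lemma integrable_pow_of_analyticAt_charFun {μ : Measure ℝ} [IsFiniteMeasure μ]
    (han : AnalyticAt ℝ (charFun μ) 0) (k : ℕ) : Integrable (fun x : ℝ => x ^ k) μ := by
  have heven : ∀ k : ℕ, Integrable (fun x : ℝ => x ^ (2 * k)) μ := by
    intro k
    induction k with
    | zero => simp
    | succ k ih => exact integrable_pow_add_two han ih
  have h2 := (heven k).add (integrable_const (1 : ℝ))
  -- `|x| ^ k ≤ x ^ (2 * k) + 1` reduces the odd moments to the even ones.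
  refine h2.mono' (by fun_prop) (.of_forall fun x => ?_)
  simp only [Pi.add_apply, norm_pow, Real.norm_eq_abs, pow_mul']
  rw [← sq_abs, abs_pow]
  nlinarith [sq_nonneg (|x| ^ k - 1)]

/-- The power series of a real variable with the given coefficients. -/
noncomputable def realPowerSeries (a : ℕ → ℂ) : FormalMultilinearSeries ℝ ℝ ℂ :=
  fun n => ContinuousMultilinearMap.mkPiRing ℝ (Fin n) (a n)

lemma realPowerSeries_coeff (a : ℕ → ℂ) (n : ℕ) : (realPowerSeries a).coeff n = a n := by
  simp [realPowerSeries, FormalMultilinearSeries.coeff]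

lemma IsAnalyticInDisk.hasSum {f : ℝ → ℂ} {a : ℕ → ℂ} {r : ℝ} (h : IsAnalyticInDisk f a r)
    {t : ℝ} (ht : |t| < r) : HasSum (fun k : ℕ => a k * (t : ℂ) ^ k) (f t) := by
  obtain ⟨F, -, hF, hf⟩ := h
  rw [← hf t ht]
  exact hF _ (by simpa using ht)

lemma eventually_abs_lt {r : ℝ} (hr : 0 < r) : ∀ᶠ t : ℝ in 𝓝 0, |t| < r := by
  filter_upwards [Metric.ball_mem_nhds (0 : ℝ) hr] with t ht
  simpa using ht

lemma IsAnalyticInDisk.hasFPowerSeriesAt {f : ℝ → ℂ} {a : ℕ → ℂ} {r : ℝ} (hr : 0 < r)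
    (h : IsAnalyticInDisk f a r) : HasFPowerSeriesAt f (realPowerSeries a) 0 := by
  rw [hasFPowerSeriesAt_iff]
  filter_upwards [eventually_abs_lt hr] with t ht
  simpa [realPowerSeries_coeff, mul_comm] using h.hasSum ht

/-- The ratio `μ_k / k!` of the `k`-th moment to `k!`. These ratios form the set `momentRatios μ`. -/
noncomputable def momentRatio (μ : Measure ℝ) (k : ℕ) : ℝ := (∫ x, x ^ k ∂μ) / (k.factorial : ℝ)

lemma IsAnalyticInDisk.coeff_eq {μ : Measure ℝ} [IsFiniteMeasure μ] {a : ℕ → ℂ} {r : ℝ}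
    (hr : 0 < r) (h : IsAnalyticInDisk (charFun μ) a r) (k : ℕ) :
    a k = Complex.I ^ k * momentRatio μ k := by
  have hp := h.hasFPowerSeriesAt hr
  have h1 := iteratedDeriv_charFun_zero (n := k) (memLp_id_of_integrable_pow
    (integrable_pow_of_analyticAt_charFun hp.analyticAt k))
  obtain ⟨ρ, hρ⟩ := hp
  have h2 := hρ.factorial_smul 1 k
  rw [← iteratedDeriv_eq_iteratedFDeriv, h1] at h2
  have h3 : (k.factorial : ℂ) ≠ 0 := by exact_mod_cast k.factorial_ne_zero
  have h4 : (realPowerSeries a k fun _ => (1 : ℝ)) = a k := realPowerSeries_coeff a k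
  rw [h4, nsmul_eq_mul] at h2
  rw [momentRatio]
  push_cast
  field_simp
  rw [mul_comm, h2]

/-- Termwise integration of `cosh (s * x) = ∑ (s * x) ^ (2 * k) / (2 * k)!` gives the series
`∑ ‖a (2 * k)‖ * s ^ (2 * k)`, which converges for `|s| < r`. -/
lemma IsAnalyticInDisk.integrable_exp_mul {μ : Measure ℝ} [IsFiniteMeasure μ] {a : ℕ → ℂ} {r : ℝ}
    (hr : 0 < r) (h : IsAnalyticInDisk (charFun μ) a r) {s : ℝ} (hs : |s| < r) :
    Integrable (fun x : ℝ => Real.exp (s * x)) μ := by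
  have hsum : Summable fun k : ℕ => ‖a (2 * k)‖ * s ^ (2 * k) := by
    have := (h.hasSum hs).summable.norm.comp_injective
      (mul_right_injective₀ (two_ne_zero (α := ℕ)))
    refine this.congr fun k => ?_
    simp [(even_two_mul k).pow_abs]
  have hint := integrable_pow_of_analyticAt_charFun (h.hasFPowerSeriesAt hr).analyticAt
  have hev : ∀ (k : ℕ) (x : ℝ), 0 ≤ x ^ (2 * k) := fun k x => (even_two_mul k).pow_nonneg x
  have hcosh : Integrable (fun x : ℝ => Real.cosh (s * x)) μ := by
    refine ⟨by fun_prop, ?_⟩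
    rw [hasFiniteIntegral_iff_ofReal (.of_forall fun x => (Real.cosh_pos _).le)]
    have e1 : ∀ x : ℝ, ENNReal.ofReal (Real.cosh (s * x)) =
        ∑' k : ℕ, ENNReal.ofReal ((s * x) ^ (2 * k) / (2 * k).factorial) := by
      intro x
      rw [← (Real.hasSum_cosh (s * x)).tsum_eq, ENNReal.ofReal_tsum_of_nonneg
        (fun k => div_nonneg (hev _ _) (by positivity)) (Real.hasSum_cosh (s * x)).summable]
    have e2 : ∀ k : ℕ, ∫⁻ x, ENNReal.ofReal ((s * x) ^ (2 * k) / (2 * k).factorial) ∂μ =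
        ENNReal.ofReal (‖a (2 * k)‖ * s ^ (2 * k)) := by
      intro k
      have e3 : (fun x : ℝ => (s * x) ^ (2 * k) / ((2 * k).factorial : ℝ)) =
          fun x => s ^ (2 * k) / (2 * k).factorial * x ^ (2 * k) := by
        ext x; ring
      rw [← ofReal_integral_eq_lintegral_ofReal
        (by rw [e3]; exact (hint _).const_mul _)
        (.of_forall fun x => div_nonneg (hev _ _) (by positivity)), e3, integral_const_mul,
        h.coeff_eq hr, norm_mul, norm_pow, Complex.norm_I, one_pow, one_mul, Complex.norm_real,
        momentRatio, Real.norm_of_nonneg (div_nonneg (integral_nonneg (hev k)) (by positivity))]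
      congr 1; ring
    simp_rw [e1]
    rw [lintegral_tsum (fun k => by fun_prop)]
    simp_rw [e2]
    rw [← ENNReal.ofReal_tsum_of_nonneg (fun k => mul_nonneg (norm_nonneg _) (hev _ _)) hsum]
    exact ENNReal.ofReal_lt_top
  refine (hcosh.const_mul 2).mono' (by fun_prop) (.of_forall fun x => ?_)
  rw [Real.norm_of_nonneg (Real.exp_pos _).le, Real.cosh_eq]
  linarith [Real.exp_pos (-(s * x))]

/-- Analyticity at `0` spreads to the whole real line, because the complex moment generating function
is holomorphic in a strip around the imaginary axis. -/
lemma IsAnalyticInDisk.analyticOnNhd_charFun {μ : Measure ℝ} [IsFiniteMeasure μ] {a : ℕ → ℂ} {r : ℝ}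
    (hr : 0 < r) (h : IsAnalyticInDisk (charFun μ) a r) :
    AnalyticOnNhd ℝ (charFun μ) Set.univ := by
  have h0 : (0 : ℝ) ∈ interior (integrableExpSet id μ) := by
    rw [mem_interior_iff_mem_nhds]
    filter_upwards [eventually_abs_lt hr] with s hs
    exact h.integrable_exp_mul hr hs
  intro t _
  have h1 : AnalyticAt ℂ (complexMGF id μ) (t * Complex.I) :=
    analyticAt_complexMGF (by simpa using h0)
  have h2 : AnalyticAt ℝ (fun t : ℝ => (t : ℂ) * Complex.I) t :=
    (Complex.ofRealCLM.analyticAt t).mul analyticAt_const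
  have h3 : AnalyticAt ℝ (complexMGF id μ ∘ fun t : ℝ => (t : ℂ) * Complex.I) t :=
    AnalyticAt.comp (g := complexMGF id μ) h1.restrictScalars h2
  exact h3.congr (.of_forall fun t => complexMGF_id_mul_I t)

/-! ### Moment ratios with finitely many values -/

lemma tendsto_factorial_add_div (j : ℕ) :
    Tendsto (fun m : ℕ => ((m + j).factorial : ℝ) / (m.factorial * (m : ℝ) ^ j)) atTop (𝓝 1) := by
  induction j with
  | zero =>
    refine tendsto_const_nhds.congr fun m => ?_
    have : (m.factorial : ℝ) ≠ 0 := by exact_mod_cast m.factorial_ne_zero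
    simp [this]
  | succ j ih =>
    have h1 : Tendsto (fun m : ℕ => 1 + ((j + 1 : ℕ) : ℝ) / m) atTop (𝓝 (1 + 0)) :=
      tendsto_const_nhds.add (tendsto_const_div_atTop_nhds_zero_nat _)
    have h2 := ih.mul h1
    simp only [add_zero, mul_one] at h2
    refine h2.congr' ?_
    filter_upwards [eventually_gt_atTop 0] with m hm
    have : (m.factorial : ℝ) ≠ 0 := by exact_mod_cast m.factorial_ne_zero
    have : (m : ℝ) ≠ 0 := by exact_mod_cast hm.ne'
    rw [← add_assoc, Nat.factorial_succ]
    push_cast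
    field_simp
    ring

/-- The quadratic form in `p`, `q`, `r` of the 3 × 3 Hankel matrix `(T (i + j))`, for the five
entries `T 0, …, T 4`. -/
def hankelForm (T : Fin 5 → ℝ) (p q r : ℝ) : ℝ :=
  p ^ 2 * T 0 + 2 * p * q * T 1 + (q ^ 2 + 2 * p * r) * T 2 + 2 * q * r * T 3 + r ^ 2 * T 4

/-- Divided by `m!`, the integral of the non-negative function
`x ^ m * (p + q * (x / m) + r * (x / m) ^ 2) ^ 2` is the Hankel form of `μ_(m+j) / (m+j)!` with
weights. The scaling by `m` makes the weights tend to `1`. -/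
lemma hankelForm_weighted_nonneg {μ : Measure ℝ} (hint : ∀ k : ℕ, Integrable (fun x : ℝ => x ^ k) μ)
    {m : ℕ} (hm : Even m) (hm0 : m ≠ 0) (p q r : ℝ) :
    0 ≤ hankelForm (fun j => ((m + j).factorial : ℝ) / (m.factorial * (m : ℝ) ^ (j : ℕ)) *
      momentRatio μ (m + j)) p q r := by
  have hm' : (m : ℝ) ≠ 0 := by exact_mod_cast hm0
  have h0 : 0 ≤ ∫ x, x ^ m * (p + q * (x / m) + r * (x / m) ^ 2) ^ 2 ∂μ :=
    integral_nonneg fun x => mul_nonneg (hm.pow_nonneg x) (sq_nonneg _)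
  have h1 : ∫ x, x ^ m * (p + q * (x / m) + r * (x / m) ^ 2) ^ 2 ∂μ =
      hankelForm (fun j => (∫ x, x ^ (m + j : ℕ) ∂μ) / (m : ℝ) ^ (j : ℕ)) p q r := by
    have e : ∀ x : ℝ, x ^ m * (p + q * (x / m) + r * (x / m) ^ 2) ^ 2 =
        p ^ 2 * x ^ m + (2 * p * q / m) * x ^ (m + 1) + ((q ^ 2 + 2 * p * r) / m ^ 2) * x ^ (m + 2)
          + (2 * q * r / m ^ 3) * x ^ (m + 3) + (r ^ 2 / m ^ 4) * x ^ (m + 4) := by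
      intro x
      field_simp
      ring
    have hc : ∀ (k : ℕ) (c : ℝ), Integrable (fun x : ℝ => c * x ^ k) μ :=
      fun k c => (hint k).const_mul c
    simp_rw [e]
    rw [integral_add ?_ (hc _ _), integral_add ?_ (hc _ _), integral_add ?_ (hc _ _),
      integral_add (hc _ _) (hc _ _)]
    rotate_left
    · exact (hc _ _).add (hc _ _)
    · exact ((hc _ _).add (hc _ _)).add (hc _ _)
    · exact (((hc _ _).add (hc _ _)).add (hc _ _)).add (hc _ _)
    simp only [integral_const_mul, hankelForm]
    simp
    ring
  rw [h1] at h0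
  have h2 : hankelForm (fun j => ((m + j).factorial : ℝ) / (m.factorial * (m : ℝ) ^ (j : ℕ)) *
      momentRatio μ (m + j)) p q r =
      hankelForm (fun j => (∫ x, x ^ (m + j : ℕ) ∂μ) / (m : ℝ) ^ (j : ℕ)) p q r / m.factorial := by
    have e : ∀ j : ℕ, ((m + j).factorial : ℝ) / (m.factorial * (m : ℝ) ^ j) * momentRatio μ (m + j)
        = (∫ x, x ^ (m + j) ∂μ) / (m : ℝ) ^ j / m.factorial := by
      intro j
      have : ((m + j).factorial : ℝ) ≠ 0 := by exact_mod_cast (m + j).factorial_ne_zero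
      have : (m.factorial : ℝ) ≠ 0 := by exact_mod_cast m.factorial_ne_zero
      rw [momentRatio]
      field_simp
    simp only [e, hankelForm]
    ring
  rw [h2]
  positivity

/-- Eventually, a sequence with finitely many values takes only values that recur. -/
lemma eventually_frequently_eq {α : Type*} {u : ℕ → α} (hu : (Set.range u).Finite) :
    ∀ᶠ k in atTop, ∃ᶠ l in atTop, u l = u k := by
  have : ∀ᶠ k in atTop, ∀ v ∈ Set.range u, (∀ᶠ l in atTop, u l ≠ v) → u k ≠ v := by
    rw [hu.eventually_all]
    intro v _
    by_cases h : ∀ᶠ l in atTop, u l ≠ v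
    · exact h.mono fun k hk _ => hk
    · exact .of_forall fun k hk => absurd hk h
  filter_upwards [this] with k hk
  by_contra h
  exact hk (u k) ⟨k, rfl⟩ (not_frequently.1 h) rfl

/-- Only finitely many 5-tuples `μ_(2k+j) / (2k+j)!` occur, so from some `k` on each of them recurs
infinitely often, and the weights of `hankelForm_weighted_nonneg` can be removed by a limit along
the recurrences. -/
lemma eventually_hankelForm_nonneg {μ : Measure ℝ}
    (hint : ∀ k : ℕ, Integrable (fun x : ℝ => x ^ k) μ)
    (hfin : (Set.range (momentRatio μ)).Finite) :
    ∀ᶠ k : ℕ in atTop, ∀ p q r : ℝ,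
      0 ≤ hankelForm (fun j => momentRatio μ (2 * k + j)) p q r := by
  have hT : (Set.range fun (k : ℕ) (j : Fin 5) => momentRatio μ (2 * k + j)).Finite := by
    refine (Set.Finite.pi' fun _ : Fin 5 => hfin).subset ?_
    rintro _ ⟨k, rfl⟩ j
    exact ⟨_, rfl⟩
  filter_upwards [eventually_frequently_eq hT] with k hk p q r
  have h2 : Tendsto (fun l : ℕ => 2 * l) atTop atTop :=
    tendsto_id.const_mul_atTop' two_pos
  have hlim : Tendsto (fun l : ℕ => hankelForm (fun j =>
      ((2 * l + j).factorial : ℝ) / ((2 * l).factorial * ((2 * l : ℕ) : ℝ) ^ (j : ℕ)) *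
        momentRatio μ (2 * k + j)) p q r) atTop
      (𝓝 (hankelForm (fun j => 1 * momentRatio μ (2 * k + j)) p q r)) := by
    have hw := fun j : Fin 5 => ((tendsto_factorial_add_div j).comp h2).mul_const
      (momentRatio μ (2 * k + j))
    exact (((((hw 0).const_mul _).add ((hw 1).const_mul _)).add ((hw 2).const_mul _)).add
      ((hw 3).const_mul _)).add ((hw 4).const_mul _)
  simp only [one_mul] at hlim
  refine ge_of_tendsto_of_frequently hlim ((hk.and_eventually (eventually_gt_atTop 0)).mono ?_)
  rintro l ⟨hl, hl0⟩
  have h3 := hankelForm_weighted_nonneg hint (even_two_mul l) (by omega) p q r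
  have h4 : ∀ j : Fin 5, momentRatio μ (2 * l + j) = momentRatio μ (2 * k + j) := congrFun hl
  simpa only [h4] using h3

/-- A positive sequence with finitely many values that is eventually log-convex is eventually
constant. -/
lemma eventually_const_of_logConvex {u : ℕ → ℝ} (hpos : ∀ k, 0 < u k)
    (hu : (Set.range u).Finite) (hlc : ∀ᶠ k in atTop, u (k + 1) ^ 2 ≤ u k * u (k + 2)) :
    ∃ C, ∀ᶠ k in atTop, u k = C := by
  -- Let `C` be the largest value taken infinitely often.
  have hV : {v ∈ Set.range u | ∃ᶠ l in atTop, u l = v}.Finite := hu.subset (Set.sep_subset _ _)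
  obtain ⟨k₀, hk₀⟩ := (eventually_frequently_eq hu).exists
  obtain ⟨C, hC⟩ := hV.exists_maximal ⟨u k₀, ⟨k₀, rfl⟩, hk₀⟩
  have hle : ∀ᶠ k in atTop, u k ≤ C := by
    filter_upwards [eventually_frequently_eq hu] with k hk
    rcases le_total (u k) C with h | h
    · exact h
    · exact hC.2 ⟨⟨k, rfl⟩, hk⟩ h
  obtain ⟨N, hN⟩ := eventually_atTop.1 (hle.and hlc)
  obtain ⟨n, hn, hnC⟩ := frequently_atTop.1 hC.1.2 (N + 1)
  obtain ⟨n, rfl⟩ : ∃ n', n = n' + 1 := ⟨n - 1, by omega⟩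
  refine ⟨C, eventually_atTop.2 ⟨n + 1, fun k hk => ?_⟩⟩
  have hC0 : 0 < C := hnC ▸ hpos _
  have step : ∀ k, N ≤ k → u (k + 1) = C → u (k + 2) = C := by
    intro k hk h
    have h1 := (hN k hk).2
    have h2 := (hN k hk).1
    refine le_antisymm (hN (k + 2) (by omega)).1 ?_
    rw [h] at h1
    have h3 : C * C ≤ C * u (k + 2) := by
      nlinarith [mul_le_mul_of_nonneg_right h2 (hpos (k + 2)).le]
    exact le_of_mul_le_mul_left h3 hC0
  induction k, hk using Nat.le_induction with
  | base => exact hnC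
  | succ k hk ih =>
    obtain ⟨k, rfl⟩ : ∃ k', k = k' + 1 := ⟨k - 1, by omega⟩
    exact step k (by omega) ih

/-- If the ratios `μ_k / k!` take finitely many values, then they are eventually constant along the
even and along the odd indices. -/
lemma exists_eventually_momentRatio_eq {μ : Measure ℝ}
    (hint : ∀ k : ℕ, Integrable (fun x : ℝ => x ^ k) μ)
    (hpos : ∀ k : ℕ, 0 < momentRatio μ (2 * k))
    (hfin : (Set.range (momentRatio μ)).Finite) :
    ∃ C D : ℝ, |D| ≤ C ∧
      ∀ᶠ k : ℕ in atTop, momentRatio μ (2 * k) = C ∧ momentRatio μ (2 * k + 1) = D := by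
  have hform := eventually_hankelForm_nonneg hint hfin
  obtain ⟨C, hC⟩ := eventually_const_of_logConvex (u := fun k => momentRatio μ (2 * k)) hpos
    (hfin.subset (by rintro _ ⟨k, rfl⟩; exact ⟨_, rfl⟩)) (by
      filter_upwards [hform] with k hk
      have h4 := hpos (k + 2)
      -- This choice of variables turns the form into `T 4 * (T 0 * T 4 - T 2 ^ 2)`.
      have h := hk (momentRatio μ (2 * (k + 2))) 0 (-momentRatio μ (2 * (k + 1)))
      simp only [hankelForm] at h
      simp at h
      ring_nf at h h4 ⊢
      nlinarith)
  obtain ⟨N, hN⟩ := eventually_atTop.1 (hC.and hform)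
  have hC0 : 0 < C := (hN N le_rfl).1 ▸ hpos N
  have hodd : ∀ k, N ≤ k → momentRatio μ (2 * (k + 1) + 1) = momentRatio μ (2 * k + 1) := by
    intro k hk
    have e0 := (hN k hk).1
    have e2 := (hN (k + 1) (by omega)).1
    have e4 := (hN (k + 2) (by omega)).1
    set d := momentRatio μ (2 * k + 1) - momentRatio μ (2 * (k + 1) + 1) with hd
    -- The even entries all equal `C`, so the form at `(-C, d, C)` is `-2 * C * d ^ 2 + C * d ^ 2`.
    have h := (hN k hk).2 (-C) d C
    simp only [hankelForm] at h
    simp at h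
    simp only [mul_add, mul_one, add_assoc, Nat.reduceMul, Nat.reduceAdd] at *
    rw [e0, e2, e4] at h
    have : C * d ^ 2 ≤ 0 := by rw [hd] at *; nlinarith
    have : d ^ 2 ≤ 0 := by nlinarith [sq_nonneg d]
    have : d = 0 := by nlinarith [sq_nonneg d]
    linarith
  have hodd' : ∀ k, N ≤ k → momentRatio μ (2 * k + 1) = momentRatio μ (2 * N + 1) := by
    intro k hk
    induction k, hk using Nat.le_induction with
    | base => rfl
    | succ k hk ih => rw [hodd k hk, ih]
  refine ⟨C, momentRatio μ (2 * N + 1), ?_, eventually_atTop.2 ⟨N, fun k hk =>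
    ⟨(hN k hk).1, hodd' k hk⟩⟩⟩
  have e0 := (hN N le_rfl).1
  have e2 := (hN (N + 1) (by omega)).1
  have h1 := (hN N le_rfl).2 1 1 0
  have h2 := (hN N le_rfl).2 1 (-1) 0
  simp only [hankelForm] at h1 h2
  simp at h1 h2
  simp only [mul_add, mul_one] at e2
  rw [abs_le]
  constructor <;> linarith

/-! ### Characteristic functions of combinations of exponential laws -/

lemma charFun_add_measure (μ ν : Measure ℝ) [IsFiniteMeasure μ] [IsFiniteMeasure ν] (t : ℝ) :
    charFun (μ + ν) t = charFun μ t + charFun ν t := by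
  have h : ∀ (ρ : Measure ℝ) [IsFiniteMeasure ρ],
      Integrable (fun x : ℝ => Complex.exp (t * x * Complex.I)) ρ := by
    intro ρ _
    refine (integrable_const (1 : ℝ)).mono' (by fun_prop) (.of_forall fun x => ?_)
    exact_mod_cast (Complex.norm_exp_ofReal_mul_I (t * x)).le
  simp only [charFun_apply_real]
  exact integral_add_measure (h μ) (h ν)

lemma charFun_smul_measure (c : NNReal) (μ : Measure ℝ) (t : ℝ) :
    charFun (c • μ) t = c * charFun μ t := by
  simp only [charFun_apply_real]
  rw [integral_smul_nnreal_measure, NNReal.smul_def, Complex.real_smul]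

lemma charFun_expMeasure_one (t : ℝ) : charFun (expMeasure 1) t = 1 / (1 - Complex.I * t) := by
  have h0 : expMeasure 1 = volume.withDensity (exponentialPDF 1) := rfl
  have hre : (-1 + t * Complex.I : ℂ).re < 0 := by simp
  have hne : (-1 + t * Complex.I : ℂ) ≠ 0 := fun h => by simp [h] at hre
  have hne' : (1 - Complex.I * t : ℂ) ≠ 0 := fun h => hne (by linear_combination -h)
  rw [charFun_apply_real, h0, integral_withDensity_eq_integral_toReal_smul
    (f := exponentialPDF 1)
    (measurable_exponentialPDFReal 1).ennreal_ofReal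
    (.of_forall fun x => ENNReal.ofReal_lt_top)]
  have h1 : ∀ x : ℝ, (exponentialPDF 1 x).toReal • Complex.exp (t * x * Complex.I) =
      (Set.Ici (0 : ℝ)).indicator (fun x : ℝ => Complex.exp ((-1 + t * Complex.I) * x)) x := by
    intro x
    by_cases hx : 0 ≤ x
    · rw [Set.indicator_of_mem (Set.mem_Ici.2 hx), exponentialPDF_of_nonneg hx,
        ENNReal.toReal_ofReal (by positivity), Complex.real_smul]
      push_cast
      rw [one_mul, ← Complex.exp_add]
      congr 1
      ring
    · rw [Set.indicator_of_notMem (by simpa using hx), exponentialPDF_of_neg (not_le.1 hx)]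
      simp
  simp_rw [h1]
  rw [integral_indicator measurableSet_Ici, integral_Ici_eq_integral_Ioi,
    integral_exp_mul_complex_Ioi hre]
  simp only [Complex.ofReal_zero, mul_zero, Complex.exp_zero]
  rw [div_eq_div_iff hne hne']
  ring

/-! ### The rational functions of the theorem -/

lemma one_add_sq_factorization (t : ℝ) :
    1 + (t : ℂ) ^ 2 = (1 + Complex.I * t) * (1 - Complex.I * t) ∧
      1 + Complex.I * t ≠ 0 ∧ 1 - Complex.I * t ≠ 0 := by
  refine ⟨by linear_combination (t : ℂ) ^ 2 * Complex.I_sq, fun h => ?_, fun h => ?_⟩ <;>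
    simpa using congrArg Complex.re h

/-- The Taylor coefficients of `(C + i D t) / (1 + t²)` at `0`: `i ^ k` times `C` for even `k`, times
`D` for odd `k`. -/
noncomputable def secondFormCoeff (C D : ℝ) (k : ℕ) : ℂ :=
  Complex.I ^ k * ((if Even k then C else D : ℝ) : ℂ)

lemma hasSum_secondFormCoeff (C D : ℝ) {z : ℂ} (hz : ‖z‖ < 1) :
    HasSum (fun k => secondFormCoeff C D k * z ^ k) ((C + Complex.I * D * z) / (1 + z ^ 2)) := by
  have hq : ‖-z ^ 2‖ < 1 := by
    rw [norm_neg, norm_pow]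
    exact pow_lt_one₀ (norm_nonneg _) hz two_ne_zero
  have h := hasSum_geometric_of_norm_lt_one hq
  rw [sub_neg_eq_add] at h
  have h1 : ∀ k : ℕ, (-z ^ 2) ^ k = (-1) ^ k * z ^ (2 * k) := fun k => by rw [neg_pow, pow_mul]
  have he : (fun k : ℕ => secondFormCoeff C D (2 * k) * z ^ (2 * k)) =
      fun k => C * (-z ^ 2) ^ k := by
    funext k
    rw [h1, secondFormCoeff, if_pos (even_two_mul k), pow_mul, Complex.I_sq]
    ring
  have ho : (fun k : ℕ => secondFormCoeff C D (2 * k + 1) * z ^ (2 * k + 1)) =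
      fun k => Complex.I * D * z * (-z ^ 2) ^ k := by
    funext k
    rw [h1, secondFormCoeff, if_neg (Nat.not_even_bit1 k), pow_succ, pow_mul, Complex.I_sq]
    ring
  have h2 := HasSum.even_add_odd (f := fun k => secondFormCoeff C D k * z ^ k)
    (he ▸ h.mul_left (C : ℂ)) (ho ▸ h.mul_left (Complex.I * D * z))
  rwa [← add_mul, ← div_eq_mul_inv] at h2

lemma finite_range_secondFormCoeff_add (C D b : ℝ) :
    (Set.range fun k : ℕ => secondFormCoeff C D k + if k = 0 then (b : ℂ) else 0).Finite := by
  refine (Set.finite_range fun x : Fin 4 × Bool =>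
    secondFormCoeff C D x.1 + if x.2 then (b : ℂ) else 0).subset ?_
  rintro _ ⟨k, rfl⟩
  refine ⟨(⟨k % 4, Nat.mod_lt _ (by norm_num)⟩, decide (k = 0)), ?_⟩
  have h1 : Even (k % 4) ↔ Even k := by rw [Nat.even_iff, Nat.even_iff]; omega
  have h2 : Complex.I ^ (k % 4) = Complex.I ^ k := by
    conv_rhs => rw [← Nat.div_add_mod k 4, pow_add, pow_mul, Complex.I_pow_four, one_pow, one_mul]
  simp [secondFormCoeff, h1, h2]

/-- Multiplying numerator and denominator of `(1 ± i a t) / (1 ± i t)` by `1 ∓ i t` gives the second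
form with `b = a`. -/
lemma IsFirstForm.isSecondForm {f : ℝ → ℂ} (h : IsFirstForm f) : IsSecondForm f := by
  obtain ⟨a, h0, h1, h | h⟩ := h
  · refine ⟨a - 1, a, h0, by linarith, by linarith, fun t => ?_⟩
    obtain ⟨e, n1, n2⟩ := one_add_sq_factorization t
    rw [h t, e, div_eq_div_iff n1 (mul_ne_zero n1 n2)]
    push_cast
    linear_combination (-(1 + Complex.I * t) * a * t ^ 2) * Complex.I_sq
  · refine ⟨1 - a, a, h0, by linarith, by linarith, fun t => ?_⟩
    obtain ⟨e, n1, n2⟩ := one_add_sq_factorization t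
    rw [h t, e, div_eq_div_iff n2 (mul_ne_zero n1 n2)]
    push_cast
    linear_combination (-(1 - Complex.I * t) * a * t ^ 2) * Complex.I_sq

lemma one_add_sq_ne_zero {z : ℂ} (hz : ‖z‖ < 1) : 1 + z ^ 2 ≠ 0 := by
  intro h
  have h1 : ‖z‖ ^ 2 = 1 := by
    rw [← norm_pow, eq_neg_of_add_eq_zero_right h, norm_neg, norm_one]
  nlinarith [norm_nonneg z]

lemma one_add_ofReal_sq_ne_zero (t : ℝ) : 1 + (t : ℂ) ^ 2 ≠ 0 := by
  have : (0 : ℝ) < 1 + t ^ 2 := by positivity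
  exact_mod_cast this.ne'

lemma IsSecondForm.exists_isAnalyticInDisk {f : ℝ → ℂ} (h : IsSecondForm f) :
    ∃ a : ℕ → ℂ, IsAnalyticInDisk f a 1 ∧ (Set.range a).Finite := by
  obtain ⟨a, b, -, -, -, h⟩ := h
  refine ⟨_, ⟨fun z => (1 + Complex.I * a * z + b * z ^ 2) / (1 + z ^ 2), ?_, ?_, fun t _ => (h t).symm⟩,
    finite_range_secondFormCoeff_add (1 - b) a b⟩
  · intro z hz
    have hz' := one_add_sq_ne_zero (z := z) (by simpa using hz)
    fun_prop (disch := assumption)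
  · intro z hz
    rw [mem_ball_zero_iff] at hz
    have h1 := (hasSum_secondFormCoeff (1 - b) a hz).add
      (hasSum_single (f := fun k : ℕ => (if k = 0 then (b : ℂ) else 0) * z ^ k) 0 (by
        intro k hk; simp [hk]))
    have hz' := one_add_sq_ne_zero hz
    convert h1 using 1
    · ext k; ring
    · push_cast
      simp only [pow_zero, mul_one]
      field_simp
      ring

/-! ### Identification of the characteristic function -/

/-- Non-degeneracy is used here, and only to exclude the point mass at `0`. -/
lemma momentRatio_pos {μ : Measure ℝ} [IsProbabilityMeasure μ] (hμ : NonDegenerate μ)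
    (hint : ∀ k : ℕ, Integrable (fun x : ℝ => x ^ k) μ) (k : ℕ) : 0 < momentRatio μ (2 * k) := by
  have hev : ∀ x : ℝ, 0 ≤ x ^ (2 * k) := fun x => (even_two_mul k).pow_nonneg x
  refine div_pos ((integral_nonneg hev).lt_of_ne' fun h => ?_) (by positivity)
  rcases eq_or_ne k 0 with rfl | hk
  · simp at h
  rw [integral_eq_zero_iff_of_nonneg hev (hint _)] at h
  apply hμ 0
  have h1 : (id : ℝ → ℝ) =ᵐ[μ] fun _ => 0 := h.mono fun x hx => by
    simpa [hk] using hx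
  calc μ = μ.map id := Measure.map_id.symm
    _ = μ.map fun _ => 0 := Measure.map_congr h1
    _ = _ := by simp [Measure.map_const]

lemma IsAnalyticInDisk.finite_range_momentRatio {μ : Measure ℝ} [IsFiniteMeasure μ] {a : ℕ → ℂ}
    {r : ℝ} (hr : 0 < r) (h : IsAnalyticInDisk (charFun μ) a r) (hfin : (Set.range a).Finite) :
    (Set.range (momentRatio μ)).Finite := by
  refine (Set.Finite.image2 (fun z (i : Fin 4) => (z / Complex.I ^ (i : ℕ)).re) hfin
    Set.finite_univ).subset ?_
  rintro _ ⟨k, rfl⟩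
  refine ⟨a k, ⟨k, rfl⟩, ⟨k % 4, Nat.mod_lt _ (by norm_num)⟩, Set.mem_univ _, ?_⟩
  have h2 : Complex.I ^ (k % 4) = Complex.I ^ k := by
    conv_rhs => rw [← Nat.div_add_mod k 4, pow_add, pow_mul, Complex.I_pow_four, one_pow, one_mul]
  have h3 : Complex.I ^ k ≠ 0 := pow_ne_zero _ Complex.I_ne_zero
  simp only [h2, h.coeff_eq hr]
  rw [mul_div_cancel_left₀ _ h3, Complex.ofReal_re]

/-- A polynomial that is bounded on the real line is constant there. -/
lemma exists_eq_const_of_bounded {N : ℕ} {e : ℕ → ℂ} {M : ℝ}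
    (h : ∀ t : ℝ, ‖∑ k ∈ Finset.range N, e k * (t : ℂ) ^ k‖ ≤ M) :
    ∃ c, ∀ t : ℝ, ∑ k ∈ Finset.range N, e k * (t : ℂ) ^ k = c := by
  set P : Polynomial ℂ := ∑ k ∈ Finset.range N, Polynomial.C (e k) * Polynomial.X ^ k with hP
  have hev : ∀ t : ℝ, P.eval (t : ℂ) = ∑ k ∈ Finset.range N, e k * (t : ℂ) ^ k := by
    intro t; simp [hP, Polynomial.eval_finsetSum]
  have hdeg : ¬ 0 < P.degree := by
    intro hd
    have := P.tendsto_norm_atTop hd (l := atTop) (z := fun t : ℝ => (t : ℂ))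
      (by simpa using tendsto_abs_atTop_atTop (G := ℝ))
    obtain ⟨t, ht⟩ := (this.eventually_gt_atTop M).exists
    rw [hev] at ht
    exact absurd (h t) (not_le.2 ht)
  refine ⟨P.coeff 0, fun t => ?_⟩
  rw [← hev, Polynomial.eq_C_of_degree_le_zero (not_lt.1 hdeg)]
  simp

/-- If `1 - C` were negative, then `μ + (C - 1) δ₀` and a combination of the exponential law and its
reflection would have the same characteristic function; but only the former charges `0`. -/
lemma le_one_of_charFun_eq {μ : Measure ℝ} [IsProbabilityMeasure μ] {C D : ℝ} (hCD : |D| ≤ C)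
    (h : ∀ t : ℝ, charFun μ t = (1 - C) + (C + Complex.I * D * t) / (1 + (t : ℂ) ^ 2)) : C ≤ 1 := by
  by_contra! hC
  have : IsProbabilityMeasure (expMeasure 1) := isProbabilityMeasure_expMeasure one_pos
  have hA : 0 ≤ (C - D) / 2 := by linarith [le_abs_self D]
  have hB : 0 ≤ (C + D) / 2 := by linarith [neg_abs_le D]
  have key : μ + (C - 1).toNNReal • Measure.dirac 0 =
      ((C - D) / 2).toNNReal • (expMeasure 1).map (fun x => -1 * x) +
        ((C + D) / 2).toNNReal • expMeasure 1 := by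
    refine Measure.ext_of_charFun (funext fun t => ?_)
    have hm : charFun ((expMeasure 1).map fun x => -1 * x) t = 1 / (1 + Complex.I * t) := by
      rw [charFun_map_mul, charFun_expMeasure_one]
      push_cast
      ring
    have c1 : (((C - 1).toNNReal : ℝ) : ℂ) = C - 1 := by
      rw [Real.coe_toNNReal _ (by linarith)]; push_cast; ring
    have c2 : ((((C - D) / 2).toNNReal : ℝ) : ℂ) = (C - D) / 2 := by
      rw [Real.coe_toNNReal _ hA]; push_cast; ring
    have c3 : ((((C + D) / 2).toNNReal : ℝ) : ℂ) = (C + D) / 2 := by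
      rw [Real.coe_toNNReal _ hB]; push_cast; ring
    obtain ⟨e, n1, n2⟩ := one_add_sq_factorization t
    rw [charFun_add_measure, charFun_add_measure, charFun_smul_measure, charFun_smul_measure,
      charFun_smul_measure, hm, charFun_expMeasure_one, h t, charFun_dirac, c1, c2, c3, e]
    simp only [inner_zero_left, Complex.ofReal_zero, zero_mul, Complex.exp_zero]
    field_simp
    ring
  have hE : expMeasure 1 {0} = 0 :=
    withDensity_absolutelyContinuous volume (exponentialPDF 1) (by simp)
  have h0 := congrArg (fun ν : Measure ℝ => ν {0}) key
  have hpre : (fun x : ℝ => -1 * x) ⁻¹' {0} = {0} := by ext; simp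
  simp only [Measure.add_apply, Measure.smul_apply, hE,
    Measure.map_apply (measurable_const_mul (-1 : ℝ)) (measurableSet_singleton 0), hpre] at h0
  simp at h0
  linarith [h0.2]

lemma isSecondForm_charFun {μ : Measure ℝ} [IsProbabilityMeasure μ] (hμ : NonDegenerate μ)
    {r : ℝ} (hr : 0 < r) {a : ℕ → ℂ} (h : IsAnalyticInDisk (charFun μ) a r)
    (hfin : (Set.range (momentRatio μ)).Finite) : IsSecondForm (charFun μ) := by
  have hint := integrable_pow_of_analyticAt_charFun (h.hasFPowerSeriesAt hr).analyticAt
  obtain ⟨C, D, hCD, hev⟩ :=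
    exists_eventually_momentRatio_eq hint (momentRatio_pos hμ hint) hfin
  obtain ⟨N, hN⟩ := eventually_atTop.1 hev
  have hcoeff : ∀ k ∉ Finset.range (2 * N), a k - secondFormCoeff C D k = 0 := by
    intro k hk
    rw [Finset.mem_range, not_lt] at hk
    rw [h.coeff_eq hr, secondFormCoeff]
    rcases Nat.even_or_odd' k with ⟨j, rfl | rfl⟩
    · simp [(hN j (by omega)).1]
    · simp [(hN j (by omega)).2, Nat.not_even_bit1]
  set P : ℝ → ℂ := fun t =>
    ∑ k ∈ Finset.range (2 * N), (a k - secondFormCoeff C D k) * (t : ℂ) ^ k with hP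
  have hnear : charFun μ =ᶠ[𝓝 0]
      fun t : ℝ => P t + (C + Complex.I * D * t) / (1 + (t : ℂ) ^ 2) := by
    filter_upwards [eventually_abs_lt hr, eventually_abs_lt one_pos] with t ht ht1
    have h1 := (h.hasSum ht).sub (hasSum_secondFormCoeff C D (z := t) (by simpa using ht1))
    have h2 : HasSum (fun k => a k * (t : ℂ) ^ k - secondFormCoeff C D k * (t : ℂ) ^ k) (P t) := by
      simp_rw [← sub_mul]
      exact hasSum_sum_of_ne_finset_zero fun k hk => by rw [hcoeff k hk, zero_mul]
    rw [← h1.unique h2]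
    ring
  have hall : ∀ t : ℝ, charFun μ t = P t + (C + Complex.I * D * t) / (1 + (t : ℂ) ^ 2) := by
    have han : AnalyticOnNhd ℝ
        (fun t : ℝ => P t + (C + Complex.I * D * t) / (1 + (t : ℂ) ^ 2)) Set.univ := by
      intro t _
      have ht : AnalyticAt ℝ (fun t : ℝ => (t : ℂ)) t := Complex.ofRealCLM.analyticAt t
      have hne := one_add_ofReal_sq_ne_zero t
      refine .add (Finset.analyticAt_fun_sum _ fun k _ => analyticAt_const.mul (ht.pow k)) ?_
      exact (analyticAt_const.add (analyticAt_const.mul ht)).div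
        (analyticAt_const.add (ht.pow 2)) hne
    exact fun t => (h.analyticOnNhd_charFun hr).eqOn_of_preconnected_of_eventuallyEq han
      isPreconnected_univ (Set.mem_univ 0) hnear (Set.mem_univ t)
  have hbound : ∀ t : ℝ, ‖P t‖ ≤ 1 + (|C| + |D|) := by
    intro t
    have e : P t = charFun μ t - (C + Complex.I * D * t) / (1 + (t : ℂ) ^ 2) := by
      rw [hall t]; ring
    rw [e]
    refine (norm_sub_le _ _).trans (add_le_add (norm_charFun_le_one t) ?_)
    have hd : ‖1 + (t : ℂ) ^ 2‖ = 1 + t ^ 2 := by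
      rw [← Real.norm_of_nonneg (by positivity : 0 ≤ 1 + t ^ 2), ← Complex.norm_real]
      push_cast
      rfl
    rw [norm_div, hd, div_le_iff₀ (by positivity)]
    refine (norm_add_le _ _).trans ?_
    simp only [norm_mul, Complex.norm_I, Complex.norm_real, Real.norm_eq_abs, one_mul, add_mul]
    have ht : |t| ≤ 1 + t ^ 2 := by nlinarith [sq_abs t, sq_nonneg (|t| - 1), abs_nonneg t]
    exact add_le_add (le_mul_of_one_le_right (abs_nonneg C) (by nlinarith [sq_nonneg t]))
      (mul_le_mul_of_nonneg_left ht (abs_nonneg D))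
  obtain ⟨c, hc⟩ := exists_eq_const_of_bounded hbound
  have hc1 : c = 1 - C := by
    have := hall 0
    rw [show P 0 = c from hc 0] at this
    simp at this
    rw [this]; ring
  have hform : ∀ t : ℝ,
      charFun μ t = (1 - C) + (C + Complex.I * D * t) / (1 + (t : ℂ) ^ 2) := by
    intro t
    rw [hall t, show P t = c from hc t, hc1]
  have hC1 := le_one_of_charFun_eq hCD hform
  refine ⟨D, 1 - C, by linarith, by linarith [le_abs_self D], by linarith [neg_abs_le D],
    fun t => ?_⟩
  have hne := one_add_ofReal_sq_ne_zero t
  rw [hform t]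
  push_cast
  field_simp
  ring

theorem theorem2 :
    (∀ (μ : Measure ℝ) [IsProbabilityMeasure μ], NonDegenerate μ →
      ∀ (r : ℝ), 0 < r → ∀ (a : ℕ → ℂ), IsAnalyticInDisk (charFun μ) a r →
        ((momentRatios μ).Finite ∨ (Set.range a).Finite) →
          IsFirstForm (charFun μ) ∨ IsSecondForm (charFun μ)) ∧
    (∀ f : ℝ → ℂ, IsFirstForm f ∨ IsSecondForm f →
      (∃ (r : ℝ) (a : ℕ → ℂ), 0 < r ∧ IsAnalyticInDisk f a r ∧ (Set.range a).Finite) ∧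
      ∀ (μ : Measure ℝ) [IsProbabilityMeasure μ], charFun μ = f →
        (∀ k : ℕ, Integrable (fun x : ℝ => x ^ k) μ) ∧ (momentRatios μ).Finite) := by
  refine ⟨fun μ _ hμ r hr a h hfin => .inr (isSecondForm_charFun hμ hr h ?_), fun f hf => ?_⟩
  · exact hfin.elim id fun hfin => h.finite_range_momentRatio hr hfin
  · obtain ⟨a, ha, hfin⟩ := (hf.elim (·.isSecondForm) id).exists_isAnalyticInDisk
    refine ⟨⟨1, a, one_pos, ha, hfin⟩, ?_⟩
    rintro μ _ rfl
    exact ⟨integrable_pow_of_analyticAt_charFun (ha.hasFPowerSeriesAt one_pos).analyticAt,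
      ha.finite_range_momentRatio one_pos hfin⟩
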